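/- All graphs are finite, simple and have at least one vertex, and $\mathbb{N}=\{1,2,3,\ldots\}$. A cover of a graph $G$ is a pair $\mathcal{H}=(L,H)$ consisting of a graph $H$ and a function $L:V(G)\to\mathcal{P}(V(H))$ such that: (1) $\{L(u):u\in V(G)\}$ is a partition of $V(H)$ into $|V(G)|$ parts; (2) $H[L(u)]$ is complete for every $u\in V(G)$; (3) if $H$ has an edge between $L(u)$ and $L(v)$, then $u=v$ or $uv\in E(G)$; (4) if $uv\in E(G)$, then the edges of $H$ between $L(u)$ and $L(v)$ form a (possibly empty) matching. The cover is $m$-fold if $|L(u)|=m$ for every $u\in V(G)$. An $\mathcal{H}$-coloring of $G$ is an independent set of size $|V(G)|$ in $H$. The DP color function $P_{DP}(G,m)$ is the minimum, over all $m$-fold covers $\mathcal{H}$ of $G$, of the number of $\mathcal{H}$-colorings of $G$. For $n\ge 2$, a vertex-gluing of vertex-disjoint graphs $G_1,\ldots,G_n$ is a graph obtained by choosing a vertex $u_i\in V(G_i)$ for each $i$ and identifying $u_1,\ldots,u_n$ as a single vertex in the disjoint union of $G_1,\ldots,G_n$. A graph is chordal if every cycle of length at least $4$ in it has a chord. **Theorem.**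 Let $n\ge 2$, and let $G_1,\ldots,G_n$ be vertex-disjoint graphs, each of which is a chordal graph or a cycle $C_k$ with $k\ge 3$. Then for every vertex-gluing $G$ of $G_1,\ldots,G_n$ and every $m\in\mathbb{N}$, $$P_{DP}(G,m)=\frac{\prod_{i=1}^{n}P_{DP}(G_i,m)}{m^{n-1}}.$$ -/

import Mathlib

namespace DPColoring

universe u v

/-- A cover `(L, H)` of a graph `G`: a finite graph `H` on a vertex set `W` together with a map
`L` from the vertices of `G` to sets of vertices of `H`. Since `H` is finite, nothing is lost by
taking `W : Type`. -/
structure Cover {V : Type u} (G : SimpleGraph V) where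
  /-- The vertex set of `H`. -/
  W : Type
  finite_W : Finite W
  /-- The graph `H`. -/
  H : SimpleGraph W
  /-- The assignment `L`. -/
  L : V → Finset W
  /-- The sets `L u` (for distinct `u`) partition the vertex set of `H` into `|V(G)|` parts:
  they are nonempty, pairwise disjoint, and cover everything. -/
  nonempty_L : ∀ x, (L x).Nonempty
  disjoint_L : ∀ x y, x ≠ y → Disjoint (L x) (L y)
  exists_mem_L : ∀ w : W, ∃ x, w ∈ L x
  /-- Each `L x` induces a complete graph in `H`. -/
  isClique_L : ∀ x, H.IsClique (L x : Set W)
  /-- If `H` has an edge between `L x` and `L y`, then `x = y` or `x y` is an edge of `G`. -/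
  eq_or_adj_of_adj : ∀ x y, ∀ a ∈ L x, ∀ b ∈ L y, H.Adj a b → x = y ∨ G.Adj x y
  /-- If `x y` is an edge of `G`, then the edges of `H` between `L x` and `L y` form a matching
  (no two of them share an endpoint; endpoints in `L y` are covered by exchanging `x` and `y`). -/
  matching : ∀ x y, G.Adj x y → ∀ a ∈ L x, ∀ b ∈ L y, ∀ c ∈ L y,
    H.Adj a b → H.Adj a c → b = c

/-- A cover is `m`-fold if every `L x` has exactly `m` elements. -/
def Cover.IsFold {V : Type u} {G : SimpleGraph V} (C : Cover G) (m : ℕ) : Prop :=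
  ∀ x, (C.L x).card = m

/-- The `C`-colorings of `G`: the independent sets of `H` of size `|V(G)|`. -/
def Cover.colorings {V : Type u} {G : SimpleGraph V} (C : Cover G) : Set (Finset C.W) :=
  {I | C.H.IsNIndepSet (Nat.card V) I}

/-- `P_DP(G, C)`: the number of `C`-colorings of `G`. -/
noncomputable def Cover.numColorings {V : Type u} {G : SimpleGraph V} (C : Cover G) : ℕ :=
  C.colorings.ncard

/-- The DP color function `P_DP(G, m)`: the minimum of `P_DP(G, C)` over all `m`-fold covers `C`
of `G`. -/
noncomputable def dpColorFunction {V : Type u} (G : SimpleGraph V) (m : ℕ) : ℕ :=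
  sInf {k | ∃ C : Cover G, C.IsFold m ∧ C.numColorings = k}

/-- `G` is chordal: every cycle of length at least `4` has a chord, i.e. an edge of `G` that joins
two vertices of the cycle but is not an edge of the cycle. -/
def IsChordal {V : Type u} (G : SimpleGraph V) : Prop :=
  ∀ (x : V) (p : G.Walk x x), p.IsCycle → 4 ≤ p.length →
    ∃ a ∈ p.support, ∃ b ∈ p.support, G.Adj a b ∧ s(a, b) ∉ p.edges

/-- `G` is a cycle `C_k` for some `k ≥ 3`. -/
def IsCycleGraph {V : Type u} (G : SimpleGraph V) : Prop :=
  ∃ k : ℕ, 3 ≤ k ∧ Nonempty (G ≃g SimpleGraph.cycleGraph k)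

/-- On the disjoint union of the vertex sets `V i`, the relation that identifies the chosen
vertices `r i` with one another, and nothing else. -/
def gluingSetoid {ι : Type v} {V : ι → Type u} (r : ∀ i, V i) : Setoid (Σ i, V i) where
  r a b := a = b ∨ (a.2 = r a.1 ∧ b.2 = r b.1)
  iseqv :=
    { refl := fun _ => Or.inl rfl
      symm := fun h => h.elim (fun e => Or.inl e.symm) (fun e => Or.inr ⟨e.2, e.1⟩)
      trans := fun h h' => by
        rcases h with rfl | ⟨h₁, h₂⟩
        · exact h'
        · rcases h' with rfl | ⟨_, h₄⟩
          · exact Or.inr ⟨h₁, h₂⟩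
          · exact Or.inr ⟨h₁, h₄⟩ }

/-- The graph obtained from the disjoint union of the graphs `G i` by identifying the chosen
vertices `r i` as a single vertex. -/
def glue {ι : Type v} {V : ι → Type u} (G : ∀ i, SimpleGraph (V i)) (r : ∀ i, V i) :
    SimpleGraph (Quotient (gluingSetoid r)) :=
  SimpleGraph.fromRel fun a b => ∃ (i : ι) (x y : V i), (G i).Adj x y ∧
    a = Quotient.mk (gluingSetoid r) ⟨i, x⟩ ∧ b = Quotient.mk (gluingSetoid r) ⟨i, y⟩

/-- `G` is (up to isomorphism) a vertex-gluing of the graphs `G' i`, i.e. it arises by choosing one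
vertex in each `G' i` and identifying the chosen vertices in the disjoint union. -/
def IsVertexGluing {ι : Type v} {V : ι → Type u} {U : Type*} (G : SimpleGraph U)
    (G' : ∀ i, SimpleGraph (V i)) : Prop :=
  ∃ r : ∀ i, V i, Nonempty (G ≃g glue G' r)

end DPColoring

namespace DPColoring

open SimpleGraph

/-! Fix a cover of the gluing and let N_i(j) be the number of colourings of G_i that give colour j
to its root. Colourings of the gluing with colour j at the shared vertex are tuples of such
colourings, so their total number is ∑_j ∏_i N_i(j) (`numProper_glue`).

The key property is `IsBalancedAt`: P_DP(G_i, m) ≤ m · N_i(j) for every cover and every j. It gives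
the lower bound factor by factor. For the upper bound, glue optimal covers: the m numbers N_i(j) sum
to P_DP(G_i, m) and none is below the average, so all equal the average
(`IsBalancedAt.eq_of_optimal`). Hence it does not matter how the colours of the roots are matched
up.

Balance for a chordal graph comes from eliminating simplicial vertices other than the root: the
ordinary colouring cover minimises the extensions at every step. For a cycle, relabelling moves all
the twisting into one permutation on one edge, and the count at j depends only on whether that
permutation fixes j. A permutation fixing all colours or none then attains any given count at every
colour. -/

/-- Conflict data on `G` with palette `Fin m`: a labelled form of an `m`-fold cover, in which
`R x y a b` says that colour `a` at `x` is matched to colour `b` at `y`. -/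
structure IsConflict {V : Type*} (G : SimpleGraph V) {m : ℕ}
    (R : V → V → Fin m → Fin m → Prop) : Prop where
  symm : ∀ x y a b, R x y a b → R y x b a
  matching : ∀ x y, G.Adj x y → ∀ a b c, R x y a b → R x y a c → b = c

/-- `f` avoids all conflicts along the edges of `G`. -/
def Proper {V : Type*} (G : SimpleGraph V) {m : ℕ} (R : V → V → Fin m → Fin m → Prop)
    (f : V → Fin m) : Prop :=
  ∀ x y, G.Adj x y → ¬ R x y (f x) (f y)

/-- The number of proper colourings. -/
noncomputable def numProper {V : Type*} (G : SimpleGraph V) {m : ℕ}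
    (R : V → V → Fin m → Fin m → Prop) : ℕ :=
  Nat.card {f : V → Fin m // Proper G R f}

/-- The number of proper colourings that take the value `j` at `u`. -/
noncomputable def numProperAt {V : Type*} (G : SimpleGraph V) {m : ℕ}
    (R : V → V → Fin m → Fin m → Prop) (u : V) (j : Fin m) : ℕ :=
  Nat.card {f : V → Fin m // Proper G R f ∧ f u = j}

theorem numProper_eq_sum {V : Type*} [Finite V] (G : SimpleGraph V) {m : ℕ}
    (R : V → V → Fin m → Fin m → Prop) (u : V) :
    numProper G R = ∑ j, numProperAt G R u j := by
  unfold numProper numProperAt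
  rw [← Nat.card_sigma]
  refine Nat.card_congr
    { toFun := fun f => ⟨f.1 u, f.1, f.2, rfl⟩
      invFun := fun p => ⟨p.2.1, p.2.2.1⟩
      left_inv := fun _ => rfl
      right_inv := ?_ }
  rintro ⟨_, f, hf, rfl⟩
  rfl

theorem isConflict_eq {V : Type*} (G : SimpleGraph V) (m : ℕ) :
    IsConflict G (m := m) fun _ _ a b => a = b :=
  ⟨fun _ _ _ _ h => h.symm, fun _ _ _ _ _ _ h h' => h.symm.trans h'⟩

/-! ### Covers as labelled conflict data -/

section Cover

variable {V : Type*} {G : SimpleGraph V} {m : ℕ}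

/-- Colourings of a cover correspond to proper colourings for a labelling of its parts. -/
theorem Cover.numColorings_eq_numProper [Finite V] (C : Cover G) (e : ∀ x, Fin m ≃ C.L x) :
    C.numColorings = numProper G fun x y a b => C.H.Adj (e x a) (e y b) := by
  classical
  have := Fintype.ofFinite V
  unfold numColorings numProper
  have inj : ∀ f : V → Fin m, Function.Injective fun x => (e x (f x) : C.W) := by
    intro f x y h
    by_contra hne
    exact Finset.disjoint_left.1 (C.disjoint_L x y hne) (e x (f x)).2
      (by simpa [← h] using (e y (f y)).2)
  rw [← Nat.card_coe_set_eq]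
  symm
  refine Nat.card_congr (Equiv.ofBijective
    (fun f => ⟨Finset.univ.image fun x => (e x (f.1 x) : C.W), ?_, ?_⟩) ⟨?_, ?_⟩)
  · intro a ha b hb hab
    simp only [Finset.coe_image, Finset.coe_univ, Set.image_univ, Set.mem_range] at ha hb
    obtain ⟨x, rfl⟩ := ha
    obtain ⟨y, rfl⟩ := hb
    intro hadj
    rcases C.eq_or_adj_of_adj x y _ (e x _).2 _ (e y _).2 hadj with rfl | h
    · exact hab rfl
    · exact f.2 x y h hadj
  · rw [Finset.card_image_of_injective _ (inj _), Nat.card_eq_fintype_card, Finset.card_univ]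
  · intro f g h
    replace h := congrArg Subtype.val h
    dsimp only at h
    ext1
    funext x
    have hx : (e x (f.1 x) : C.W) ∈ Finset.univ.image fun x => (e x (g.1 x) : C.W) := by
      rw [← h]
      exact Finset.mem_image_of_mem _ (Finset.mem_univ x)
    obtain ⟨y, -, hy⟩ := Finset.mem_image.1 hx
    have hyx : y = x := by
      by_contra hne
      exact Finset.disjoint_left.1 (C.disjoint_L y x hne) (e y (g.1 y)).2
        (by simp [hy])
    subst hyx
    exact (e y).injective (Subtype.ext hy.symm)
  · rintro ⟨I, hI, hcard⟩
    choose part hpart using C.exists_mem_L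
    have hinj : Set.InjOn part (I : Set C.W) := by
      intro a ha b hb hab
      by_contra hne
      exact hI ha hb hne (C.isClique_L (part a) (hpart a)
        (by rw [hab]; exact hpart b) hne)
    have himg : I.image part = Finset.univ := by
      rw [← Finset.card_eq_iff_eq_univ, Finset.card_image_of_injOn hinj, hcard,
        Nat.card_eq_fintype_card]
    have hex : ∀ x, ∃ w ∈ I, w ∈ C.L x := by
      intro x
      have hx : x ∈ I.image part := by simp [himg]
      obtain ⟨w, hw, rfl⟩ := Finset.mem_image.1 hx
      exact ⟨w, hw, hpart w⟩
    choose w hwI hwL using hex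
    have hval : ∀ x, (e x ((e x).symm ⟨w x, hwL x⟩) : C.W) = w x := fun x => by simp
    refine ⟨⟨fun x => (e x).symm ⟨w x, hwL x⟩, fun x y hxy => ?_⟩, Subtype.ext ?_⟩
    · simp only [hval]
      intro h
      exact hI (hwI x) (hwI y) h.ne h
    · refine Finset.eq_of_subset_of_card_le ?_ ?_
      · intro a ha
        obtain ⟨x, -, rfl⟩ := Finset.mem_image.1 ha
        simpa only [hval] using hwI x
      · rw [Finset.card_image_of_injective _ (inj fun x => (e x).symm ⟨w x, hwL x⟩), hcard,
          Nat.card_eq_fintype_card, Finset.card_univ]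

theorem Cover.exists_conflict [Finite V] (C : Cover G) (hC : C.IsFold m) :
    ∃ R : V → V → Fin m → Fin m → Prop, IsConflict G R ∧ numProper G R = C.numColorings := by
  let e : ∀ x, Fin m ≃ C.L x := fun x => ((C.L x).equivFinOfCardEq (hC x)).symm
  exact ⟨_, ⟨fun x y a b h => h.symm, fun x y hxy a b c h h' => (e y).injective (Subtype.ext
    (C.matching x y hxy _ (e x a).2 _ (e y b).2 _ (e y c).2 h h'))⟩,
    (C.numColorings_eq_numProper e).symm⟩

theorem IsConflict.exists_cover [Finite V] (hm : 1 ≤ m) {R : V → V → Fin m → Fin m → Prop}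
    (hR : IsConflict G R) : ∃ C : Cover G, C.IsFold m ∧ C.numColorings = numProper G R := by
  classical
  -- Numbering the vertices places the vertex set of `H` in `Type`, whatever the universe of `V`.
  obtain ⟨N, ⟨t⟩⟩ := Finite.exists_equiv_fin V
  have : NeZero m := ⟨by omega⟩
  let C : Cover G :=
    { W := Fin N × Fin m
      finite_W := inferInstance
      H :=
        { Adj := fun p q => (p.1 = q.1 ∧ p.2 ≠ q.2) ∨
            (G.Adj (t.symm p.1) (t.symm q.1) ∧ R (t.symm p.1) (t.symm q.1) p.2 q.2)
          symm := ⟨by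
            rintro p q (⟨h, h'⟩ | ⟨h, h'⟩)
            · exact Or.inl ⟨h.symm, h'.symm⟩
            · exact Or.inr ⟨h.symm, hR.symm _ _ _ _ h'⟩⟩
          loopless := ⟨by
            rintro p (⟨_, h⟩ | ⟨h, _⟩)
            · exact h rfl
            · exact h.ne rfl⟩ }
      L := fun x => {t x} ×ˢ Finset.univ
      nonempty_L := fun x => ⟨(t x, 0), by simp⟩
      disjoint_L := fun x y h => by
        rw [Finset.disjoint_left]
        rintro ⟨p, a⟩ h1 h2
        simp only [Finset.mem_product, Finset.mem_singleton, Finset.mem_univ, and_true] at h1 h2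
        exact h (t.injective (h1.symm.trans h2))
      exists_mem_L := fun w => ⟨t.symm w.1, by simp⟩
      isClique_L := fun x => by
        rintro ⟨p, a⟩ h1 ⟨q, b⟩ h2 hne
        simp only [Finset.coe_product, Finset.coe_singleton, Finset.coe_univ, Set.mem_prod,
          Set.mem_singleton_iff, Set.mem_univ, and_true] at h1 h2
        subst h1 h2
        exact Or.inl ⟨rfl, fun h => hne (by simpa using h)⟩
      eq_or_adj_of_adj := fun x y => by
        rintro ⟨p, a⟩ h1 ⟨q, b⟩ h2 h
        simp only [Finset.mem_product, Finset.mem_singleton, Finset.mem_univ, and_true] at h1 h2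
        subst h1 h2
        rcases h with ⟨h, -⟩ | ⟨h, -⟩
        · exact Or.inl (t.injective h)
        · exact Or.inr (by simpa using h)
      matching := fun x y hxy => by
        rintro ⟨p, a⟩ h1 ⟨q, b⟩ h2 ⟨q', c⟩ h3 h h'
        simp only [Finset.mem_product, Finset.mem_singleton, Finset.mem_univ, and_true]
          at h1 h2 h3
        subst h1 h2 h3
        rcases h with ⟨h, -⟩ | ⟨-, h⟩
        · exact absurd (t.injective h) hxy.ne
        rcases h' with ⟨h', -⟩ | ⟨-, h'⟩
        · exact absurd (t.injective h') hxy.ne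
        simp only [Equiv.symm_apply_apply] at h h'
        rw [hR.matching x y hxy a b c h h'] }
  let e : ∀ x, Fin m ≃ C.L x := fun x =>
    { toFun := fun a => ⟨(t x, a), by simp [C]⟩
      invFun := fun p => p.1.2
      left_inv := fun _ => rfl
      right_inv := by
        rintro ⟨⟨p, a⟩, h⟩
        have h' : p = t x := by simpa [C, eq_comm] using h
        subst h'
        rfl }
  refine ⟨C, fun x => by simp [C], ?_⟩
  rw [C.numColorings_eq_numProper e]
  refine Nat.card_congr (Equiv.subtypeEquivRight fun f => forall₃_congr fun x y hxy => ?_)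
  refine not_congr ⟨?_, fun h => ?_⟩
  · rintro (⟨h, -⟩ | ⟨-, h⟩)
    · exact absurd (t.injective h) hxy.ne
    · simpa [e] using h
  · exact Or.inr ⟨by simpa [e] using hxy, by simpa [e] using h⟩

theorem dpColorFunction_le [Finite V] (hm : 1 ≤ m) {R : V → V → Fin m → Fin m → Prop}
    (hR : IsConflict G R) : dpColorFunction G m ≤ numProper G R :=
  Nat.sInf_le (hR.exists_cover hm)

/-- The infimum is over a nonempty set, thanks to the ordinary colouring cover, so it is attained
and is not the default value 0. -/
theorem exists_dpColorFunction_eq [Finite V] (hm : 1 ≤ m) (G : SimpleGraph V) :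
    ∃ R : V → V → Fin m → Fin m → Prop,
      IsConflict G R ∧ dpColorFunction G m = numProper G R := by
  have hne : {k | ∃ C : Cover G, C.IsFold m ∧ C.numColorings = k}.Nonempty := by
    obtain ⟨C, hC, -⟩ := (isConflict_eq G m).exists_cover hm
    exact ⟨_, C, hC, rfl⟩
  obtain ⟨C, hC, h⟩ := Nat.sInf_mem hne
  obtain ⟨R, hR, h'⟩ := C.exists_conflict hC
  exact ⟨R, hR, h.symm.trans h'.symm⟩

end Cover

/-! ### Invariance under isomorphism -/

section Iso

variable {V W : Type*} {G : SimpleGraph V} {G' : SimpleGraph W} {m : ℕ}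

theorem IsConflict.comap (e : G ≃g G') {R : W → W → Fin m → Fin m → Prop}
    (hR : IsConflict G' R) : IsConflict G fun x y => R (e x) (e y) :=
  ⟨fun _ _ => hR.symm _ _, fun _ _ h => hR.matching _ _ (e.map_adj_iff.2 h)⟩

theorem proper_comap_iff (e : G ≃g G') (R : W → W → Fin m → Fin m → Prop) (f : W → Fin m) :
    Proper G (fun x y => R (e x) (e y)) (f ∘ e) ↔ Proper G' R f := by
  refine ⟨fun h x y hxy => ?_, fun h x y hxy => h _ _ (e.map_adj_iff.2 hxy)⟩
  simpa using h (e.symm x) (e.symm y) (e.symm.map_adj_iff.2 hxy)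

theorem numProperAt_comap (e : G ≃g G') (R : W → W → Fin m → Fin m → Prop) (u : V)
    (j : Fin m) : numProperAt G (fun x y => R (e x) (e y)) u j = numProperAt G' R (e u) j := by
  symm
  refine Nat.card_congr ((e.toEquiv.symm.arrowCongr (Equiv.refl _)).subtypeEquiv fun f => ?_)
  exact and_congr (proper_comap_iff e R f).symm Iff.rfl

theorem numProper_comap (e : G ≃g G') (R : W → W → Fin m → Fin m → Prop) :
    numProper G (fun x y => R (e x) (e y)) = numProper G' R := by
  symm
  exact Nat.card_congr ((e.toEquiv.symm.arrowCongr (Equiv.refl _)).subtypeEquiv fun f =>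
    (proper_comap_iff e R f).symm)

theorem dpColorFunction_le_of_iso [Finite V] [Finite W] (hm : 1 ≤ m) (e : G ≃g G') :
    dpColorFunction G m ≤ dpColorFunction G' m := by
  obtain ⟨R, hR, h⟩ := exists_dpColorFunction_eq hm G'
  rw [h, ← numProper_comap e]
  exact dpColorFunction_le hm (hR.comap e)

theorem dpColorFunction_congr [Finite V] [Finite W] (hm : 1 ≤ m) (e : G ≃g G') :
    dpColorFunction G m = dpColorFunction G' m :=
  (dpColorFunction_le_of_iso hm e).antisymm (dpColorFunction_le_of_iso hm e.symm)

end Iso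

/-- In every `m`-fold cover, every colour of `u` extends to at least `P_DP(G, m) / m`
colourings. -/
def IsBalancedAt {V : Type*} (G : SimpleGraph V) (m : ℕ) (u : V) : Prop :=
  ∀ R : V → V → Fin m → Fin m → Prop, IsConflict G R →
    ∀ j, dpColorFunction G m ≤ m * numProperAt G R u j

theorem IsBalancedAt.of_iso {V W : Type*} [Finite V] [Finite W] {G : SimpleGraph V}
    {G' : SimpleGraph W} {m : ℕ} (hm : 1 ≤ m) (e : G ≃g G') {u : V}
    (h : IsBalancedAt G' m (e u)) : IsBalancedAt G m u := by
  intro R hR j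
  have h1 := numProperAt_comap e (fun x y => R (e.symm x) (e.symm y)) u j
  simp only [RelIso.symm_apply_apply] at h1
  rw [dpColorFunction_congr hm e, h1]
  exact h _ (hR.comap e.symm) j

/-! ### Simplicial vertices of chordal graphs -/

section Chordal

variable {V : Type*} {G : SimpleGraph V}

/-- In a chordal graph, two neighbours of `u` joined by a walk whose other vertices are neither `u`
nor neighbours of `u` are adjacent. -/
theorem IsChordal.adj_of_walk (hG : IsChordal G) {u x y : V} (hx : G.Adj u x) (hy : G.Adj u y)
    (hxy : x ≠ y) (p : G.Walk x y)
    (hp : ∀ w ∈ p.support, w = x ∨ w = y ∨ (w ≠ u ∧ ¬ G.Adj u w)) : G.Adj x y := by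
  classical
  by_contra hnadj
  have hex : ∃ l, ∃ q : G.Walk x y, q.length = l ∧
      ∀ w ∈ q.support, w = x ∨ w = y ∨ (w ≠ u ∧ ¬ G.Adj u w) := ⟨_, p, rfl, hp⟩
  -- A shortest such walk is a path. Closed up through `u` it is a cycle of length at least 4, and a
  -- chord would either shorten it or join `u` to an interior vertex.
  obtain ⟨q, hql, hq⟩ := Nat.find_spec hex
  have hmin : ∀ q' : G.Walk x y, (∀ w ∈ q'.support, w ∈ q.support) →
      q.length ≤ q'.length := by
    intro q' hq'
    rw [hql]
    exact Nat.find_min' hex ⟨q', rfl, fun w hw => hq w (hq' w hw)⟩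
  have hpath : q.IsPath := by
    have h1 := hmin q.bypass fun w hw => q.support_bypass_subset_support hw
    have h2 : q.bypass = q := Walk.bypass_eq_self_of_length_le_length_bypass q h1
    rw [← h2]
    exact q.bypass_isPath
  have huq : u ∉ q.support := by
    intro hu
    rcases hq u hu with h | h | h
    · exact hx.ne h
    · exact hy.ne h
    · exact h.1 rfl
  have hlen : 2 ≤ q.length := by
    by_contra hlt
    have h01 : q.length = 0 ∨ q.length = 1 := by omega
    rcases h01 with h | h
    · exact hxy (Walk.eq_of_length_eq_zero h)
    · exact hnadj (Walk.adj_of_length_eq_one h)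
  have hcyc : (Walk.cons hx (q.concat hy.symm)).IsCycle := by
    rw [Walk.cons_isCycle_iff]
    refine ⟨hpath.concat huq hy.symm, ?_⟩
    rw [Walk.edges_concat]
    intro h
    simp only [List.concat_eq_append, List.mem_append, List.mem_singleton] at h
    rcases h with h | h
    · exact huq (Walk.fst_mem_support_of_mem_edges q h)
    · rw [Sym2.eq_iff] at h
      rcases h with ⟨h, -⟩ | ⟨-, h⟩
      · exact hy.ne h
      · exact hxy h
  obtain ⟨a, ha, b, hb, hab, hchord⟩ := hG u _ hcyc (by simp; omega)
  have hnbr : ∀ w, w ∈ q.support → G.Adj u w →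
      s(u, w) ∈ (Walk.cons hx (q.concat hy.symm)).edges := by
    intro w hw hadj
    rcases hq w hw with rfl | rfl | h
    · simp
    · simp [Walk.edges_concat, Sym2.eq_swap]
    · exact absurd hadj h.2
  have hmem : ∀ w, w ∈ (Walk.cons hx (q.concat hy.symm)).support → w = u ∨ w ∈ q.support := by
    intro w hw
    simpa [Walk.support_concat, or_comm, or_assoc] using hw
  have hqe : ∀ e ∈ q.edges, e ∈ (Walk.cons hx (q.concat hy.symm)).edges := by
    intro e he
    simp [Walk.edges_concat, he]
  have key : ∀ i j, i < j → j ≤ q.length → G.Adj (q.getVert i) (q.getVert j) →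
      s(q.getVert i, q.getVert j) ∈ q.edges := by
    intro i j hij hj hadj
    have h1 := hmin ((q.take i).append (Walk.cons hadj (q.drop j))) (by
      intro w hw
      rw [Walk.mem_support_append_iff, Walk.support_cons, List.mem_cons] at hw
      rcases hw with hw | rfl | hw
      · exact (q.isSubwalk_take i).support_subset hw
      · exact q.getVert_mem_support i
      · exact (q.isSubwalk_drop j).support_subset hw)
    rw [Walk.length_append, Walk.length_cons, Walk.take_length, Walk.drop_length,
      min_eq_left (by omega)] at h1
    obtain rfl : j = i + 1 := by omega
    have hi : i < q.edges.length := by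
      rw [Walk.length_edges]
      omega
    rw [← Walk.getElem_edges hi]
    exact List.getElem_mem hi
  rcases hmem a ha with rfl | ha'
  · rcases hmem b hb with rfl | hb'
    · exact hab.ne rfl
    · exact hchord (hnbr b hb' hab)
  rcases hmem b hb with rfl | hb'
  · exact hchord (Sym2.eq_swap ▸ hnbr a ha' hab.symm)
  obtain ⟨i, rfl, hi⟩ := Walk.mem_support_iff_exists_getVert.1 ha'
  obtain ⟨j, rfl, hj⟩ := Walk.mem_support_iff_exists_getVert.1 hb'
  rcases lt_trichotomy i j with h | rfl | h
  · exact hchord (hqe _ (key i j h hj hab))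
  · exact hab.ne rfl
  · exact hchord (hqe _ (Sym2.eq_swap ▸ key j i h hi hab.symm))

/-- The neighbours of `v` in `A` are pairwise adjacent. -/
def SimplicialIn (G : SimpleGraph V) (A : Finset V) (v : V) : Prop :=
  ∀ x ∈ A, ∀ y ∈ A, G.Adj v x → G.Adj v y → x ≠ y → G.Adj x y

/-- Let `K` be the component of `k` among the non-neighbours of `u` in `A`, and `S` the neighbours
of `u` in `A` that touch `K`. By `IsChordal.adj_of_walk`, `S` is a clique. Neighbours in `A` of a
vertex of `K` stay in `B = K ∪ S`, which omits `u`, so it suffices to find a vertex of `K`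
simplicial in `B`. -/
theorem IsChordal.exists_simplicialIn_not_adj (hG : IsChordal G) (A : Finset V) :
    ∀ u ∈ A, (∃ w ∈ A, w ≠ u ∧ ¬ G.Adj u w) →
      ∃ v ∈ A, v ≠ u ∧ ¬ G.Adj u v ∧ SimplicialIn G A v := by
  classical
  induction A using Finset.strongInduction with
  | H A ih =>
  rintro u hu ⟨k, hkA, hku, hk⟩
  let P : V → Prop := fun w => w ∈ A ∧ w ≠ u ∧ ¬ G.Adj u w
  let K : V → Prop := fun z => ∃ p : G.Walk k z, ∀ w ∈ p.support, P w
  have hKP : ∀ z, K z → P z := fun z ⟨p, hp⟩ => hp z p.end_mem_support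
  have hkK : K k := ⟨Walk.nil, by simpa using ⟨hkA, hku, hk⟩⟩
  let S : V → Prop := fun s => s ∈ A ∧ G.Adj u s ∧ ∃ z, K z ∧ G.Adj s z
  have hclosed : ∀ z, K z → ∀ s ∈ A, G.Adj z s → K s ∨ S s := by
    rintro z ⟨p, hp⟩ s hs hzs
    by_cases hus : G.Adj u s
    · exact Or.inr ⟨hs, hus, z, ⟨p, hp⟩, hzs.symm⟩
    · left
      refine ⟨p.concat hzs, fun w hw => ?_⟩
      rw [Walk.support_concat] at hw
      simp only [List.mem_append, List.mem_singleton] at hw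
      rcases hw with hw | rfl
      · exact hp w hw
      · refine ⟨hs, ?_, hus⟩
        rintro rfl
        exact (hp z p.end_mem_support).2.2 hzs.symm
  have hclique : ∀ x y, S x → S y → x ≠ y → G.Adj x y := by
    rintro x y ⟨hxA, hux, z, ⟨p, hp⟩, hxz⟩ ⟨hyA, huy, z', ⟨p', hp'⟩, hyz⟩ hxy
    refine hG.adj_of_walk hux huy hxy
      (Walk.cons hxz ((p.reverse.append p').concat hyz.symm)) fun w hw => ?_
    simp only [Walk.support_cons, Walk.support_concat, List.mem_cons, List.mem_append,
      Walk.mem_support_append_iff,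
      Walk.support_reverse, List.mem_reverse, List.not_mem_nil, or_false] at hw
    rcases hw with rfl | (hw | hw) | rfl
    · exact Or.inl rfl
    · exact Or.inr (Or.inr (hp w hw).2)
    · exact Or.inr (Or.inr (hp' w hw).2)
    · exact Or.inr (Or.inl rfl)
  let B : Finset V := A.filter fun w => K w ∨ S w
  have hBA : B ⊂ A := by
    refine Finset.filter_ssubset.2 ⟨u, hu, ?_⟩
    rintro (h | h)
    · exact (hKP u h).2.1 rfl
    · exact h.2.1.ne rfl
  have hlift : ∀ z, K z → SimplicialIn G B z →
      ∃ v ∈ A, v ≠ u ∧ ¬ G.Adj u v ∧ SimplicialIn G A v := by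
    intro z hz hs
    refine ⟨z, (hKP z hz).1, (hKP z hz).2.1, (hKP z hz).2.2, fun x hx y hy hzx hzy hxy => ?_⟩
    exact hs x (Finset.mem_filter.2 ⟨hx, hclosed z hz x hx hzx⟩)
      y (Finset.mem_filter.2 ⟨hy, hclosed z hz y hy hzy⟩) hzx hzy hxy
  -- Induction is applied at a vertex of `S`, else of `K`, that misses some vertex of `B`; the
  -- vertex found cannot lie in `S`. If there is no such vertex, `B` is a clique and `k` is
  -- simplicial.
  by_cases hS : ∃ s ∈ B, S s ∧ ∃ w ∈ B, w ≠ s ∧ ¬ G.Adj s w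
  · obtain ⟨s, hsB, hsS, hw⟩ := hS
    obtain ⟨v, hvB, hvs, hnv, hv⟩ := ih B hBA s hsB hw
    rcases (Finset.mem_filter.1 hvB).2 with hvK | hvS
    · exact hlift v hvK hv
    · exact absurd (hclique s v hsS hvS hvs.symm) hnv
  · by_cases hK : ∃ c ∈ B, K c ∧ ∃ w ∈ B, w ≠ c ∧ ¬ G.Adj c w
    · obtain ⟨c, hcB, hcK, hw⟩ := hK
      obtain ⟨v, hvB, hvc, hnv, hv⟩ := ih B hBA c hcB hw
      rcases (Finset.mem_filter.1 hvB).2 with hvK | hvS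
      · exact hlift v hvK hv
      · exact absurd ⟨v, hvB, hvS, c, hcB, hvc.symm, fun h => hnv h.symm⟩ hS
    · refine hlift k hkK fun x hx y hy _ _ hxy => ?_
      by_contra hadj
      rcases (Finset.mem_filter.1 hx).2 with h | h
      · exact hK ⟨x, hx, h, y, hy, hxy.symm, hadj⟩
      · exact hS ⟨x, hx, h, y, hy, hxy.symm, hadj⟩

/-- Dirac's theorem: avoiding any prescribed vertex, there is a simplicial vertex. -/
theorem IsChordal.exists_simplicialIn (hG : IsChordal G) (A : Finset V) (u : V) (hu : u ∈ A)
    (hA : A ≠ {u}) : ∃ v ∈ A, v ≠ u ∧ SimplicialIn G A v := by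
  classical
  by_cases h : ∃ w ∈ A, w ≠ u ∧ ¬ G.Adj u w
  · obtain ⟨v, hv, hvu, -, h⟩ := hG.exists_simplicialIn_not_adj A u hu h
    exact ⟨v, hv, hvu, h⟩
  push Not at h
  obtain ⟨w, hw, hwu⟩ : ∃ w ∈ A, w ≠ u := by
    by_contra! hall
    exact hA (Finset.eq_singleton_iff_unique_mem.2 ⟨hu, hall⟩)
  -- Here `u` is adjacent to all of `A`, so being simplicial in `A.erase u` implies being simplicial
  -- in `A`.
  by_cases h' : ∃ c ∈ A.erase u, ∃ d ∈ A.erase u, d ≠ c ∧ ¬ G.Adj c d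
  · obtain ⟨c, hc, hd⟩ := h'
    obtain ⟨v, hv, -, -, hs⟩ := hG.exists_simplicialIn_not_adj (A.erase u) c hc hd
    obtain ⟨hvu, hvA⟩ := Finset.mem_erase.1 hv
    refine ⟨v, hvA, hvu, fun x hx y hy hvx hvy hxy => ?_⟩
    by_cases hxu : x = u
    · subst hxu
      exact h y hy hxy.symm
    by_cases hyu : y = u
    · subst hyu
      exact (h x hx hxy).symm
    exact hs x (Finset.mem_erase.2 ⟨hxu, hx⟩) y (Finset.mem_erase.2 ⟨hyu, hy⟩) hvx hvy hxy
  · push Not at h'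
    refine ⟨w, hw, hwu, fun x hx y hy _ _ hxy => ?_⟩
    by_cases hxu : x = u
    · subst hxu
      exact h y hy hxy.symm
    by_cases hyu : y = u
    · subst hyu
      exact (h x hx hxy).symm
    exact h' x (Finset.mem_erase.2 ⟨hxu, hx⟩) y (Finset.mem_erase.2 ⟨hyu, hy⟩) hxy.symm

end Chordal

/-! ### Balance of chordal graphs -/

section ChordalCount

variable {V : Type*} {G : SimpleGraph V} {m : ℕ}

/-- `f` avoids all conflicts along the edges of `G` inside `A`. -/
def ProperOn (G : SimpleGraph V) (A : Finset V) (R : V → V → Fin m → Fin m → Prop)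
    (f : V → Fin m) : Prop :=
  ∀ x ∈ A, ∀ y ∈ A, G.Adj x y → ¬ R x y (f x) (f y)

/-- The number of maps `V → Fin m` that are proper on `A` and take the value `j` at `u`. -/
noncomputable def numProperOnAt (G : SimpleGraph V) (A : Finset V)
    (R : V → V → Fin m → Fin m → Prop) (u : V) (j : Fin m) : ℕ :=
  Nat.card {f : V → Fin m // ProperOn G A R f ∧ f u = j}

theorem numProperOnAt_univ [Fintype V] (R : V → V → Fin m → Fin m → Prop) (u : V) (j : Fin m) :
    numProperOnAt G Finset.univ R u j = numProperAt G R u j :=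
  Nat.card_congr (Equiv.subtypeEquivRight fun f => by simp [ProperOn, Proper])

theorem properOn_update_iff [DecidableEq V] {A : Finset V} {v : V} (hv : v ∈ A)
    {R : V → V → Fin m → Fin m → Prop} (hR : IsConflict G R) (f : V → Fin m) (b : Fin m) :
    ProperOn G A R (Function.update f v b) ↔
      ProperOn G (A.erase v) R f ∧ ∀ w ∈ A, G.Adj v w → ¬ R v w b (f w) := by
  constructor
  · intro h
    refine ⟨fun x hx y hy hxy => ?_, fun w hw hvw => ?_⟩
    · obtain ⟨hxv, hxA⟩ := Finset.mem_erase.1 hx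
      obtain ⟨hyv, hyA⟩ := Finset.mem_erase.1 hy
      simpa [hxv, hyv] using h x hxA y hyA hxy
    · simpa [hvw.ne'] using h v hv w hw hvw
  · rintro ⟨h, h'⟩ x hx y hy hxy
    by_cases hxv : x = v
    · subst hxv
      simpa [hxy.ne'] using h' y hy hxy
    by_cases hyv : y = v
    · subst hyv
      simpa [hxy.ne] using fun hr => h' x hx hxy.symm (hR.symm _ _ _ _ hr)
    simpa [hxv, hyv] using
      h x (Finset.mem_erase.2 ⟨hxv, hx⟩) y (Finset.mem_erase.2 ⟨hyv, hy⟩) hxy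

/-- Maps are defined on all of `V`, so the value at `v` is unconstrained once `v` leaves `A`; the
factor `m` accounts for it. The bijection exchanges the colour of `v` with a spare colour. -/
theorem numProperOnAt_mul [Finite V] [DecidableEq V] {A : Finset V} {u v : V} (hv : v ∈ A)
    (hvu : v ≠ u) {R : V → V → Fin m → Fin m → Prop} (hR : IsConflict G R) (j : Fin m)
    [Fintype {f : V → Fin m // ProperOn G (A.erase v) R f ∧ f u = j}] :
    numProperOnAt G A R u j * m =
      ∑ f : {f : V → Fin m // ProperOn G (A.erase v) R f ∧ f u = j},
        Nat.card {b : Fin m // ∀ w ∈ A, G.Adj v w → ¬ R v w b (f.1 w)} := by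
  rw [← Nat.card_sigma]
  unfold numProperOnAt
  have hprod := Nat.card_prod {f : V → Fin m // ProperOn G A R f ∧ f u = j} (Fin m)
  rw [Nat.card_fin] at hprod
  rw [← hprod]
  refine Nat.card_congr
    { toFun := fun p => ⟨⟨Function.update p.1.1 v p.2, ?_, ?_⟩, p.1.1 v, ?_⟩
      invFun := fun p => ⟨⟨Function.update p.1.1 v p.2.1, ?_, ?_⟩, p.1.1 v⟩
      left_inv := ?_
      right_inv := ?_ }
  · have h := p.1.2.1
    rw [← Function.update_eq_self v p.1.1, properOn_update_iff hv hR] at h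
    intro x hx y hy hxy
    simpa [(Finset.mem_erase.1 hx).1, (Finset.mem_erase.1 hy).1] using h.1 x hx y hy hxy
  · simpa [hvu.symm] using p.1.2.2
  · have h := p.1.2.1
    rw [← Function.update_eq_self v p.1.1, properOn_update_iff hv hR] at h
    intro w hw hvw
    simpa [hvw.ne'] using h.2 w hw hvw
  · exact (properOn_update_iff hv hR _ _).2 ⟨p.1.2.1, p.2.2⟩
  · simpa [hvu.symm] using p.1.2.2
  · rintro ⟨⟨f, hf⟩, c⟩
    simp
  · rintro ⟨⟨f, hf⟩, c, hc⟩
    refine Sigma.subtype_ext ?_ ?_ <;> simp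

/-- Each coloured neighbour forbids at most one colour at `v`, by the matching condition. -/
theorem IsConflict.sub_le_card_free {R : V → V → Fin m → Fin m → Prop} (hR : IsConflict G R)
    (f : V → Fin m) (v : V) (N : Finset V) (hN : ∀ w ∈ N, G.Adj v w) :
    m - N.card ≤ Nat.card {b : Fin m // ∀ w ∈ N, ¬ R v w b (f w)} := by
  classical
  rw [Nat.card_eq_fintype_card, Fintype.card_subtype]
  have hbad : (Finset.univ.filter fun b => ∀ w ∈ N, ¬ R v w b (f w))ᶜ ⊆
      N.biUnion fun w => Finset.univ.filter fun b => R v w b (f w) := by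
    intro b hb
    simpa using hb
  have hcard := (Finset.card_le_card hbad).trans
    (Finset.card_biUnion_le_card_mul N _ 1 fun w hw => Finset.card_le_one.2 fun a ha b hb =>
      hR.matching w v (hN w hw).symm (f w) a b (hR.symm _ _ _ _ (Finset.mem_filter.1 ha).2)
        (hR.symm _ _ _ _ (Finset.mem_filter.1 hb).2))
  rw [Finset.card_compl, Fintype.card_fin] at hcard
  omega

theorem card_free_eq (f : V → Fin m) (N : Finset V) (hf : Set.InjOn f N) :
    Nat.card {b : Fin m // ∀ w ∈ N, ¬ b = f w} = m - N.card := by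
  classical
  rw [Nat.card_eq_fintype_card, Fintype.card_subtype]
  have h : (Finset.univ.filter fun b => ∀ w ∈ N, ¬ b = f w) = (N.image f)ᶜ := by
    ext b
    simp [eq_comm]
  rw [h, Finset.card_compl, Fintype.card_fin, Finset.card_image_of_injOn hf]

/-- For a chordal graph, the cover given by ordinary colourings has, for every colour of a vertex,
the fewest colourings among all covers and all colours of that vertex. -/
theorem IsChordal.numProperOnAt_eq_le [Finite V] (hm : 1 ≤ m) (hG : IsChordal G)
    {R : V → V → Fin m → Fin m → Prop} (hR : IsConflict G R) (u : V) (a j : Fin m)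
    (A : Finset V) :
    u ∈ A → numProperOnAt G A (fun _ _ a b => a = b) u a ≤ numProperOnAt G A R u j := by
  classical
  have := Fintype.ofFinite V
  induction A using Finset.strongInduction with
  | H A ih =>
  intro hu
  by_cases hA : A = {u}
  · subst hA
    have htriv : ∀ (R : V → V → Fin m → Fin m → Prop) f, ProperOn G {u} R f := by
      intro R f x hx y hy hxy
      rw [Finset.mem_singleton] at hx hy
      subst hx hy
      exact absurd hxy (G.loopless.irrefl _)
    -- With no edges inside `{u}` nothing is forbidden, and swapping `a` with `j` matches the two
    -- sets of maps.
    refine (Nat.card_congr (((Equiv.refl V).arrowCongr (Equiv.swap a j)).subtypeEquiv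
      fun f => ?_)).le
    simp [htriv, Equiv.swap_apply_eq_iff]
  obtain ⟨v, hv, hvu, hs⟩ := hG.exists_simplicialIn A u hu hA
  have hle := ih (A.erase v) (Finset.erase_ssubset hv) (Finset.mem_erase.2 ⟨hvu.symm, hu⟩)
  let N := A.filter fun w => G.Adj v w
  have hN : ∀ (R : V → V → Fin m → Fin m → Prop) (f : V → Fin m),
      Nat.card {b : Fin m // ∀ w ∈ A, G.Adj v w → ¬ R v w b (f w)} =
        Nat.card {b : Fin m // ∀ w ∈ N, ¬ R v w b (f w)} := fun R f =>
    Nat.card_congr (Equiv.subtypeEquivRight fun b => by simp [N])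
  refine Nat.le_of_mul_le_mul_right ?_ hm
  rw [numProperOnAt_mul hv hvu (isConflict_eq G m), numProperOnAt_mul hv hvu hR]
  calc _ = numProperOnAt G (A.erase v) (fun _ _ a b => a = b) u a * (m - N.card) := by
        -- The neighbours `N` of the simplicial vertex form a clique, so ordinary colourings use
        -- distinct colours on it and forbid exactly `N.card` colours, the most possible.
        have hinj : ∀ f : V → Fin m, ProperOn G (A.erase v) (fun _ _ a b => a = b) f →
            Set.InjOn f N := by
          intro f hf x hx y hy hxy
          obtain ⟨hxA, hvx⟩ := Finset.mem_filter.1 hx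
          obtain ⟨hyA, hvy⟩ := Finset.mem_filter.1 hy
          by_contra hne
          exact hf x (Finset.mem_erase.2 ⟨hvx.ne', hxA⟩) y
            (Finset.mem_erase.2 ⟨hvy.ne', hyA⟩) (hs x hxA y hyA hvx hvy hne) hxy
        rw [Finset.sum_congr rfl fun f _ => (hN (fun _ _ a b => a = b) f.1).trans
          (card_free_eq f.1 N (hinj f.1 f.2.1)), Finset.sum_const, Finset.card_univ, smul_eq_mul,
          numProperOnAt, Nat.card_eq_fintype_card]
    _ ≤ numProperOnAt G (A.erase v) R u j * (m - N.card) := Nat.mul_le_mul_right _ hle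
    _ ≤ _ := by
        rw [numProperOnAt, Nat.card_eq_fintype_card, ← smul_eq_mul, ← Finset.card_univ]
        refine Finset.card_nsmul_le_sum _ _ _ fun f _ => ?_
        rw [hN R f.1]
        exact hR.sub_le_card_free f.1 v N fun w hw => (Finset.mem_filter.1 hw).2

/-- `P_DP` is at most the number of ordinary colourings, a sum over the `m` colours of `u` of terms
each at most the count for `R` at `j`. -/
theorem IsChordal.isBalancedAt [Finite V] (hm : 1 ≤ m) (hG : IsChordal G) (u : V) :
    IsBalancedAt G m u := by
  intro R hR j
  have := Fintype.ofFinite V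
  refine (dpColorFunction_le hm (isConflict_eq G m)).trans ?_
  rw [numProper_eq_sum G _ u]
  refine (Finset.sum_le_card_nsmul _ _ (numProperAt G R u j) fun a _ => ?_).trans (by simp)
  rw [← numProperOnAt_univ, ← numProperOnAt_univ]
  exact hG.numProperOnAt_eq_le hm hR u a j _ (Finset.mem_univ u)

end ChordalCount

/-! ### Balance of cycles -/

section Cycle

variable {k m : ℕ}

theorem cycleGraph_adj_iff {x y : Fin (k + 3)} :
    (cycleGraph (k + 3)).Adj x y ↔ y = x + 1 ∨ x = y + 1 := by
  rw [cycleGraph_adj, sub_eq_iff_eq_add', sub_eq_iff_eq_add', or_comm]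

/-- The conflicts on a cycle in which colour `a` at `x` is matched to `σ x a` at `x + 1`. -/
def permConflict (σ : Fin (k + 3) → Equiv.Perm (Fin m)) (x y : Fin (k + 3)) (a b : Fin m) : Prop :=
  (y = x + 1 ∧ σ x a = b) ∨ (x = y + 1 ∧ σ y b = a)

theorem isConflict_permConflict (σ : Fin (k + 3) → Equiv.Perm (Fin m)) :
    IsConflict (cycleGraph (k + 3)) (permConflict σ) := by
  -- With at least three vertices, an edge is traversed as a successor step in only one direction,
  -- so the two clauses of `permConflict` never mix.
  have hne : ∀ x : Fin (k + 3), x ≠ x + 1 + 1 := by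
    intro x h
    rw [add_assoc, left_eq_add] at h
    exact absurd (congrArg Fin.val h) (by
      rw [Fin.val_add]
      simp [Nat.mod_eq_of_lt])
  refine ⟨fun x y a b h => h.symm, fun x y _ a b c h h' => ?_⟩
  rcases h with ⟨rfl, rfl⟩ | ⟨rfl, rfl⟩
  · rcases h' with ⟨-, h⟩ | ⟨h, -⟩
    · exact h
    · exact absurd h (hne x)
  · rcases h' with ⟨h, -⟩ | ⟨-, h⟩
    · exact absurd h (hne y)
    · exact (σ y).injective h.symm

theorem proper_permConflict_iff (σ : Fin (k + 3) → Equiv.Perm (Fin m)) (f : Fin (k + 3) → Fin m) :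
    Proper (cycleGraph (k + 3)) (permConflict σ) f ↔ ∀ x, σ x (f x) ≠ f (x + 1) := by
  constructor
  · intro h x hx
    exact h x (x + 1) (cycleGraph_adj_iff.2 (Or.inl rfl)) (Or.inl ⟨rfl, hx⟩)
  · rintro h x y - (⟨rfl, h'⟩ | ⟨rfl, h'⟩)
    · exact h _ h'
    · exact h _ h'

theorem exists_perm_of_partial_matching (r : Fin m → Fin m → Prop)
    (h1 : ∀ a b c, r a b → r a c → b = c) (h2 : ∀ a b c, r a c → r b c → a = b) :
    ∃ σ : Equiv.Perm (Fin m), ∀ a b, r a b → σ a = b := by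
  classical
  let s : Finset (Fin m) := Finset.univ.filter fun a => ∃ b, r a b
  have hs : ∀ a ∈ s, ∃ b, r a b := fun a ha => (Finset.mem_filter.1 ha).2
  let f : Fin m → Fin m := fun a => if h : ∃ b, r a b then h.choose else a
  have hf : ∀ a b, r a b → f a = b := by
    intro a b hab
    have h : ∃ b, r a b := ⟨b, hab⟩
    have hfa : f a = h.choose := dif_pos h
    rw [hfa]
    exact h1 a _ _ h.choose_spec hab
  obtain ⟨g, hg⟩ := Finset.exists_equiv_extend_of_card_eq (t := (Finset.univ : Finset (Fin m)))
    (by simp) (s := s) (f := f) (Finset.subset_univ _) (by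
      intro a ha b hb hab
      obtain ⟨c, hc⟩ := hs a ha
      obtain ⟨d, hd⟩ := hs b hb
      rw [hf a c hc, hf b d hd] at hab
      subst hab
      exact h2 _ _ _ hc hd)
  refine ⟨g.trans (Equiv.subtypeUnivEquiv Finset.mem_univ), fun a b hab => ?_⟩
  have := hg a (Finset.mem_filter.2 ⟨Finset.mem_univ a, b, hab⟩)
  simpa [this] using hf a b hab

/-- Completing each partial matching to a permutation only adds conflicts. -/
theorem exists_permConflict_le {R : Fin (k + 3) → Fin (k + 3) → Fin m → Fin m → Prop}
    (hR : IsConflict (cycleGraph (k + 3)) R) (u : Fin (k + 3)) (j : Fin m) :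
    ∃ σ : Fin (k + 3) → Equiv.Perm (Fin m),
      numProperAt (cycleGraph (k + 3)) (permConflict σ) u j ≤
        numProperAt (cycleGraph (k + 3)) R u j := by
  have hadj : ∀ x : Fin (k + 3), (cycleGraph (k + 3)).Adj x (x + 1) :=
    fun x => cycleGraph_adj_iff.2 (Or.inl rfl)
  choose σ hσ using fun x => exists_perm_of_partial_matching (R x (x + 1))
    (hR.matching _ _ (hadj x)) fun a b c h h' =>
      hR.matching _ _ (hadj x).symm c a b (hR.symm _ _ _ _ h) (hR.symm _ _ _ _ h')
  refine ⟨σ, Nat.card_le_card_of_injective (Subtype.map id ?_)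
    (Subtype.map_injective _ Function.injective_id)⟩
  rintro f ⟨hf, hu⟩
  rw [proper_permConflict_iff] at hf
  refine ⟨fun x y hxy h => ?_, hu⟩
  rcases cycleGraph_adj_iff.1 hxy with rfl | rfl
  · exact hf _ (hσ _ _ _ h)
  · exact hf _ (hσ _ _ _ (hR.symm _ _ _ _ h))

/-- Matchings on a cycle that are the identity except for `ρ` from the last vertex to `0`. -/
def closeWith (k : ℕ) (ρ : Equiv.Perm (Fin m)) (x : Fin (k + 3)) : Equiv.Perm (Fin m) :=
  if x = Fin.last (k + 2) then ρ else 1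

/-- Colours at `x` are renamed by `τ x`, chosen recursively to straighten every matching along the
path from `0` to the last vertex. Only the closing edge keeps a twist, and `τ 0 = 1` preserves the
colour `j`. -/
theorem exists_closeWith_eq (σ : Fin (k + 3) → Equiv.Perm (Fin m)) (j : Fin m) :
    ∃ ρ, numProperAt (cycleGraph (k + 3)) (permConflict (closeWith k ρ)) 0 j =
      numProperAt (cycleGraph (k + 3)) (permConflict σ) 0 j := by
  let τ : Fin (k + 3) → Equiv.Perm (Fin m) := fun x =>
    Fin.induction (motive := fun _ => Equiv.Perm (Fin m)) 1
      (fun i t => t * (σ i.castSucc)⁻¹) x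
  have hτ0 : τ 0 = 1 := rfl
  have hτs : ∀ i : Fin (k + 2), τ i.succ = τ i.castSucc * (σ i.castSucc)⁻¹ := fun i => rfl
  refine ⟨σ (Fin.last _) * (τ (Fin.last _))⁻¹, ?_⟩
  symm
  refine Nat.card_congr ((Equiv.piCongrRight τ).subtypeEquiv fun f => and_congr ?_ ?_)
  · rw [proper_permConflict_iff, proper_permConflict_iff]
    refine forall_congr' fun x => not_congr ?_
    have hx : closeWith k (σ (Fin.last _) * (τ (Fin.last _))⁻¹) x * τ x = τ (x + 1) * σ x := by
      induction x using Fin.lastCases with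
      | last => simp [closeWith, hτ0]
      | cast i =>
        rw [closeWith, if_neg (Fin.castSucc_lt_last i).ne, Fin.coeSucc_eq_succ, hτs]
        simp
    have hx' := DFunLike.congr_fun hx (f x)
    simp only [Equiv.Perm.mul_apply] at hx'
    simp only [Equiv.piCongrRight_apply, Pi.map_apply]
    rw [hx', (τ (x + 1)).apply_eq_iff_eq]
  · simp [hτ0]

/-- Given `f 0 = j = ρ t`, the closing edge says only that the last vertex avoids `t`. All other
matchings are identities, so the count is unchanged when `π` renames colours everywhere and carries
`(t, j)` to `(t', j')`. -/
theorem numProperAt_closeWith_congr {ρ ρ' π : Equiv.Perm (Fin m)} {t t' j j' : Fin m}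
    (ht : ρ t = j) (ht' : ρ' t' = j') (hπ : π t = t') (hπj : π j = j') :
    numProperAt (cycleGraph (k + 3)) (permConflict (closeWith k ρ)) 0 j =
      numProperAt (cycleGraph (k + 3)) (permConflict (closeWith k ρ')) 0 j' := by
  subst ht hπ hπj
  refine Nat.card_congr (((Equiv.refl _).arrowCongr π).subtypeEquiv fun f => ?_)
  rw [proper_permConflict_iff, proper_permConflict_iff]
  simp only [Equiv.arrowCongr_apply, Equiv.refl_symm, Equiv.coe_refl, Function.comp_apply, id_eq,
    π.apply_eq_iff_eq]
  refine and_congr_left fun h0 => forall_congr' fun x => not_congr ?_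
  induction x using Fin.lastCases with
  | last =>
    simp only [closeWith, if_true, Fin.last_add_one, h0]
    rw [← ht', ρ.apply_eq_iff_eq, ρ'.apply_eq_iff_eq, π.apply_eq_iff_eq]
  | cast i => simp [closeWith, (Fin.castSucc_lt_last i).ne]

theorem exists_perm_map_pair {α : Type*} [DecidableEq α] {t j t' j' : α}
    (h : t = j ↔ t' = j') : ∃ π : Equiv.Perm α, π t = t' ∧ π j = j' := by
  by_cases htj : t = j
  · obtain rfl := h.1 htj
    subst htj
    exact ⟨Equiv.swap t t', by simp⟩
  · refine ⟨Equiv.swap (Equiv.swap j j' t) t' * Equiv.swap j j', by simp, ?_⟩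
    rw [Equiv.Perm.mul_apply, Equiv.swap_apply_left]
    refine Equiv.swap_apply_of_ne_of_ne ?_ fun e => htj (h.2 e.symm)
    intro e
    rw [eq_comm, Equiv.swap_apply_eq_iff, Equiv.swap_apply_right] at e
    exact htj e

/-- The count at `j` depends only on whether `ρ` fixes `j`. The identity fixes every colour and
`finRotate` fixes none when `m ≥ 2`; for `m = 1` the non-fixed case cannot occur. -/
theorem exists_uniform_closeWith (ρ : Equiv.Perm (Fin m)) (j : Fin m) :
    ∃ ρ' : Equiv.Perm (Fin m), ∀ j', numProperAt (cycleGraph (k + 3)) (permConflict (closeWith k ρ')) 0 j' =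
      numProperAt (cycleGraph (k + 3)) (permConflict (closeWith k ρ)) 0 j := by
  obtain ⟨ρ', hρ'⟩ : ∃ ρ' : Equiv.Perm (Fin m), ∀ j', ρ⁻¹ j = j ↔ ρ'⁻¹ j' = j' := by
    by_cases h : ρ⁻¹ j = j
    · exact ⟨1, by simp [h]⟩
    · refine ⟨finRotate m, fun j' => iff_of_false h ?_⟩
      match m, ρ, j, h, j' with
      | 1, _, _, h, _ => exact absurd (Subsingleton.elim _ _) h
      | m + 2, _, _, _, j' =>
        rw [Equiv.Perm.inv_eq_iff_eq, finRotate_apply, left_eq_add]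
        simp
  refine ⟨ρ', fun j' => ?_⟩
  obtain ⟨π, h1, h2⟩ := exists_perm_map_pair (hρ' j')
  exact (numProperAt_closeWith_congr (by simp) (by simp) h1 h2).symm

theorem isBalancedAt_cycleGraph_zero (hm : 1 ≤ m) :
    IsBalancedAt (cycleGraph (k + 3)) m 0 := by
  intro R hR j
  obtain ⟨σ, hσ⟩ := exists_permConflict_le hR 0 j
  obtain ⟨ρ, hρ⟩ := exists_closeWith_eq σ j
  obtain ⟨ρ', hρ'⟩ := exists_uniform_closeWith (k := k) ρ j
  calc _ ≤ numProper _ (permConflict (closeWith k ρ')) :=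
        dpColorFunction_le hm (isConflict_permConflict _)
    _ = m * numProperAt (cycleGraph (k + 3)) (permConflict σ) 0 j := by
        rw [numProper_eq_sum _ _ 0, Finset.sum_congr rfl fun j' _ => (hρ' j').trans hρ]
        simp
    _ ≤ _ := Nat.mul_le_mul_left m hσ

theorem IsCycleGraph.isBalancedAt {V : Type*} [Finite V] {G : SimpleGraph V} (hm : 1 ≤ m)
    (hG : IsCycleGraph G) (u : V) : IsBalancedAt G m u := by
  obtain ⟨n, hn, ⟨e⟩⟩ := hG
  obtain ⟨k, rfl⟩ := Nat.exists_eq_add_of_le' hn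
  -- A rotation carries the chosen vertex to `0`.
  let rot : cycleGraph (k + 3) ≃g cycleGraph (k + 3) :=
    { toEquiv := Equiv.subRight (e u)
      map_rel_iff' := by
        intro x y
        simp [cycleGraph_adj] }
  refine IsBalancedAt.of_iso hm (e.trans rot) ?_
  have h : (e.trans rot) u = 0 := sub_self (e u)
  rw [h]
  exact isBalancedAt_cycleGraph_zero hm

end Cycle

/-! ### Counting on vertex-gluings -/

section Glue

variable {ι : Type*} {V : ι → Type*} {r : ∀ i, V i} {G : ∀ i, SimpleGraph (V i)} {m : ℕ}

theorem gluing_mk_eq_iff {p q : Σ i, V i} :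
    Quotient.mk (gluingSetoid r) p = Quotient.mk (gluingSetoid r) q ↔
      p = q ∨ (p.2 = r p.1 ∧ q.2 = r q.1) :=
  Quotient.eq

theorem glue_adj_mk {i : ι} {x y : V i} (h : (G i).Adj x y) :
    (glue G r).Adj (Quotient.mk _ ⟨i, x⟩) (Quotient.mk _ ⟨i, y⟩) := by
  rw [glue, SimpleGraph.fromRel_adj]
  refine ⟨fun he => ?_, Or.inl ⟨i, x, y, h, rfl, rfl⟩⟩
  rcases gluing_mk_eq_iff.1 he with he | ⟨hx, hy⟩
  · exact h.ne (eq_of_heq (Sigma.mk.inj he).2)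
  · exact h.ne (hx.trans hy.symm)

theorem glue_adj_iff {p q : Quotient (gluingSetoid r)} :
    (glue G r).Adj p q ↔ ∃ (i : ι) (x y : V i), (G i).Adj x y ∧
      p = Quotient.mk _ ⟨i, x⟩ ∧ q = Quotient.mk _ ⟨i, y⟩ := by
  constructor
  · intro h
    rw [glue, SimpleGraph.fromRel_adj] at h
    rcases h.2 with h | ⟨i, x, y, h, hx, hy⟩
    · exact h
    · exact ⟨i, y, x, h.symm, hy, hx⟩
  · rintro ⟨i, x, y, h, rfl, rfl⟩
    exact glue_adj_mk h

/-- The ends of an edge are distinct, so at least one is not the root, and that end determines its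
summand. -/
theorem gluing_edge_unique {i i' : ι} {x y : V i} {x' y' : V i'} (h : (G i).Adj x y)
    (h' : (G i').Adj x' y')
    (hx : Quotient.mk (gluingSetoid r) ⟨i, x⟩ = Quotient.mk (gluingSetoid r) ⟨i', x'⟩)
    (hy : Quotient.mk (gluingSetoid r) ⟨i, y⟩ = Quotient.mk (gluingSetoid r) ⟨i', y'⟩) :
    (⟨i, x, y⟩ : Σ i, V i × V i) = ⟨i', x', y'⟩ := by
  rcases gluing_mk_eq_iff.1 hx with ex | ⟨ex, ex'⟩ <;>
    rcases gluing_mk_eq_iff.1 hy with ey | ⟨ey, ey'⟩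
  · cases ex
    cases ey
    rfl
  · cases ex
    dsimp only at ey ey'
    rw [ey, ey']
  · cases ey
    dsimp only at ex ex'
    rw [ex, ex']
  · exact absurd (ex.trans ey.symm) h.ne

theorem IsConflict.restrict_glue
    {R : Quotient (gluingSetoid r) → Quotient (gluingSetoid r) → Fin m → Fin m → Prop}
    (hR : IsConflict (glue G r) R) (i : ι) :
    IsConflict (G i) fun x y => R (Quotient.mk _ ⟨i, x⟩) (Quotient.mk _ ⟨i, y⟩) :=
  ⟨fun _ _ => hR.symm _ _, fun _ _ h => hR.matching _ _ (glue_adj_mk h)⟩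

theorem proper_glue_iff
    (R : Quotient (gluingSetoid r) → Quotient (gluingSetoid r) → Fin m → Fin m → Prop)
    (f : Quotient (gluingSetoid r) → Fin m) :
    Proper (glue G r) R f ↔
      ∀ i, Proper (G i) (fun x y => R (Quotient.mk _ ⟨i, x⟩) (Quotient.mk _ ⟨i, y⟩))
        fun x => f (Quotient.mk _ ⟨i, x⟩) := by
  constructor
  · exact fun h i x y hxy => h _ _ (glue_adj_mk hxy)
  · intro h p q hpq
    obtain ⟨i, x, y, hxy, rfl, rfl⟩ := glue_adj_iff.1 hpq
    exact h i x y hxy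

theorem numProper_glue [Fintype ι] [Nonempty ι] [∀ i, Finite (V i)]
    (R : Quotient (gluingSetoid r) → Quotient (gluingSetoid r) → Fin m → Fin m → Prop) :
    numProper (glue G r) R = ∑ j, ∏ i, numProperAt (G i)
      (fun x y => R (Quotient.mk _ ⟨i, x⟩) (Quotient.mk _ ⟨i, y⟩)) (r i) j := by
  unfold numProper numProperAt
  simp_rw [← Nat.card_pi]
  rw [← Nat.card_sigma]
  symm
  refine Nat.card_congr (Equiv.ofBijective (fun g =>
    ⟨Quotient.lift (fun p => (g.2 p.1).1 p.2) ?_, (proper_glue_iff _ _).2 fun i => (g.2 i).2.1⟩)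
    ⟨?_, ?_⟩)
  · rintro p q (rfl | ⟨h, h'⟩)
    · rfl
    · rw [h, h', (g.2 p.1).2.2, (g.2 q.1).2.2]
  · rintro ⟨j, g⟩ ⟨j', g'⟩ h
    have hval : ∀ i x, (g i).1 x = (g' i).1 x := fun i x =>
      congrFun (congrArg Subtype.val h) (Quotient.mk _ ⟨i, x⟩)
    obtain ⟨i₀⟩ := ‹Nonempty ι›
    have hj : j = j' := by rw [← (g i₀).2.2, ← (g' i₀).2.2, hval]
    subst hj
    rw [funext fun i => Subtype.ext (funext (hval i))]
  · rintro ⟨f, hf⟩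
    obtain ⟨i₀⟩ := ‹Nonempty ι›
    refine ⟨⟨f (Quotient.mk _ ⟨i₀, r i₀⟩), fun i => ⟨fun x => f (Quotient.mk _ ⟨i, x⟩),
      (proper_glue_iff _ _).1 hf i, congrArg f (Quotient.sound (Or.inr ⟨rfl, rfl⟩))⟩⟩, ?_⟩
    refine Subtype.ext (funext fun p => ?_)
    induction p using Quotient.ind
    rfl

/-- Edges of distinct summands stay distinct in the gluing, so their conflicts can be prescribed
independently. `R'` need only agree with `R i` along edges, hence the statement through counts. -/
theorem exists_glue_conflict (R : ∀ i, V i → V i → Fin m → Fin m → Prop)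
    (hR : ∀ i, IsConflict (G i) (R i)) :
    ∃ R' : Quotient (gluingSetoid r) → Quotient (gluingSetoid r) → Fin m → Fin m → Prop,
      IsConflict (glue G r) R' ∧ ∀ i u j, numProperAt (G i)
        (fun x y => R' (Quotient.mk _ ⟨i, x⟩) (Quotient.mk _ ⟨i, y⟩)) u j =
          numProperAt (G i) (R i) u j := by
  let R' : Quotient (gluingSetoid r) → Quotient (gluingSetoid r) → Fin m → Fin m → Prop :=
    fun p q a b => ∃ (i : ι) (x y : V i), (G i).Adj x y ∧
      p = Quotient.mk _ ⟨i, x⟩ ∧ q = Quotient.mk _ ⟨i, y⟩ ∧ R i x y a b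
  have hR' : ∀ i x y a b, (G i).Adj x y →
      (R' (Quotient.mk _ ⟨i, x⟩) (Quotient.mk _ ⟨i, y⟩) a b ↔ R i x y a b) := by
    intro i x y a b hxy
    refine ⟨?_, fun h => ⟨i, x, y, hxy, rfl, rfl, h⟩⟩
    rintro ⟨i', x', y', hxy', hx, hy, h⟩
    cases gluing_edge_unique hxy hxy' hx hy
    exact h
  refine ⟨R', ⟨?_, ?_⟩, fun i u j => ?_⟩
  · rintro p q a b ⟨i, x, y, hxy, hp, hq, h⟩
    exact ⟨i, y, x, hxy.symm, hq, hp, (hR i).symm _ _ _ _ h⟩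
  · intro p q hpq a b c h h'
    obtain ⟨i, x, y, hxy, rfl, rfl⟩ := glue_adj_iff.1 hpq
    rw [hR' i x y _ _ hxy] at h h'
    exact (hR i).matching x y hxy a b c h h'
  · refine Nat.card_congr (Equiv.subtypeEquivRight fun f => and_congr_left fun _ => ?_)
    exact forall₃_congr fun x y hxy => not_congr (hR' i x y _ _ hxy)

/-- If every colour of `u` extends to at least the average number of colourings, then in an optimal
cover every colour extends to exactly the average number. -/
theorem IsBalancedAt.eq_of_optimal {W : Type*} [Finite W] {G : SimpleGraph W} {u : W}
    (h : IsBalancedAt G m u) {R : W → W → Fin m → Fin m → Prop} (hR : IsConflict G R)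
    (hopt : dpColorFunction G m = numProper G R) (j : Fin m) :
    m * numProperAt G R u j = dpColorFunction G m := by
  have hsum : ∑ _j : Fin m, dpColorFunction G m = ∑ j, m * numProperAt G R u j := by
    rw [← Finset.mul_sum, ← numProper_eq_sum, ← hopt]
    simp
  -- Termwise inequality together with equal sums forces termwise equality.
  exact ((Finset.sum_eq_sum_iff_of_le fun j _ => h R hR j).1 hsum j (Finset.mem_univ j)).symm

/-- Scaling by one factor `m` per summand turns each N_i(j) into m · N_i(j), which balance bounds
below by P_DP(G_i, m), with equality in optimal covers. This avoids division in `ℕ`. -/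
theorem dpColorFunction_glue [Fintype ι] [Nonempty ι] [∀ i, Finite (V i)] (hm : 1 ≤ m)
    (h : ∀ i, IsBalancedAt (G i) m (r i)) :
    m ^ Fintype.card ι * dpColorFunction (glue G r) m = m * ∏ i, dpColorFunction (G i) m := by
  have hscale : ∀ N : ι → Fin m → ℕ,
      m ^ Fintype.card ι * ∑ j, ∏ i, N i j = ∑ j, ∏ i, m * N i j := by
    intro N
    rw [Finset.mul_sum]
    exact Finset.sum_congr rfl fun j _ => by
      rw [Finset.prod_mul_distrib, Finset.prod_const, Finset.card_univ]
  apply le_antisymm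
  · choose R hR hopt using fun i => exists_dpColorFunction_eq hm (G i)
    obtain ⟨R', hR', hcount⟩ := exists_glue_conflict (r := r) R hR
    refine (Nat.mul_le_mul_left _ (dpColorFunction_le hm hR')).trans_eq ?_
    rw [numProper_glue, hscale]
    simp only [hcount, (h _).eq_of_optimal (hR _) (hopt _)]
    simp
  · obtain ⟨R, hR, hopt⟩ := exists_dpColorFunction_eq hm (glue G r)
    rw [hopt, numProper_glue, hscale]
    calc m * ∏ i, dpColorFunction (G i) m = ∑ _j : Fin m, ∏ i, dpColorFunction (G i) m := by simp
      _ ≤ _ := Finset.sum_le_sum fun j _ => Finset.prod_le_prod' fun i _ =>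
        h i _ (hR.restrict_glue i) j

end Glue

end DPColoring

theorem mainTheorem4 {n : ℕ} (hn : 2 ≤ n) {V : Fin n → Type*} [∀ i, Finite (V i)]
    (G' : ∀ i, SimpleGraph (V i))
    (hG' : ∀ i, DPColoring.IsChordal (G' i) ∨ DPColoring.IsCycleGraph (G' i))
    {U : Type*} (G : SimpleGraph U) (hG : DPColoring.IsVertexGluing G G')
    (m : ℕ) (hm : 1 ≤ m) :
    (DPColoring.dpColorFunction G m : ℚ) =
      (∏ i, (DPColoring.dpColorFunction (G' i) m : ℚ)) / (m : ℚ) ^ (n - 1) := by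
  obtain ⟨r, ⟨e⟩⟩ := hG
  have : Finite U := Finite.of_equiv _ e.toEquiv.symm
  have : Nonempty (Fin n) := ⟨⟨0, by omega⟩⟩
  have hmul := DPColoring.dpColorFunction_glue (r := r) hm fun i =>
    (hG' i).elim (fun h => h.isBalancedAt hm (r i)) fun h => h.isBalancedAt hm (r i)
  rw [← DPColoring.dpColorFunction_congr hm e, Fintype.card_fin] at hmul
  obtain ⟨k, rfl⟩ : ∃ k, n = k + 1 := ⟨n - 1, by omega⟩
  rw [pow_succ', mul_assoc] at hmul
  have hmul' := Nat.eq_of_mul_eq_mul_left hm hmul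
  have hm0 : (m : ℚ) ≠ 0 := by exact_mod_cast (show m ≠ 0 by omega)
  rw [Nat.add_sub_cancel, eq_div_iff (pow_ne_zero _ hm0), mul_comm]
  exact_mod_cast hmul'
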